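/- A (finite, simple) graph is \emph{quasi-threshold} if it belongs to the smallest isomorphism-closed family of graphs that contains the one-vertex graph $K_1$ and is closed under adding a dominating vertex (a new vertex adjacent to all existing vertices) and under taking disjoint unions. For $n,\ell\ge 1$ let $\mathrm{qt}_{n,\ell}$ be the number of quasi-threshold graphs on the labelled vertex set $[n]=\{1,\dots,n\}$ with exactly $\ell$ connected components. Let $S(n,k)$ denote the Stirling number of the second kind. Then for all $n\ge1$ and $\ell\ge1$, $$\mathrm{qt}_{n,\ell}=\sum_{k=1}^{n}(-1)^{n-k}\,S(n,k)\,\ell\binom{k}{\ell}k^{k-\ell-1},$$ where the sum is of rational numbers, and $k^{k-\ell-1}$ may have a negative exponent (for $k=\ell$ the factor $\ell\binom{k}{\ell}k^{k-\ell-1}$ equals $1$, and for $k<\ell$ it equals $0$). In particular, the number of connected quasi-threshold graphs on the labelled vertex set $[n]$ is $$\sum_{k=1}^{n}(-1)^{n+k}\,S(n,k)\,k^{k-1}.$$ -/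

import Mathlib

namespace SimpleGraph

/-- The graph obtained from `G` by adding one new vertex `none`, adjacent to every vertex of `G`. -/
def addDominating {V : Type} (G : SimpleGraph V) : SimpleGraph (Option V) where
  Adj x y :=
    match x, y with
    | none, none => False
    | none, some _ => True
    | some _, none => True
    | some a, some b => G.Adj a b
  symm := ⟨fun x y h => by
    cases x <;> cases y <;> first | exact SimpleGraph.Adj.symm (G := G) h | exact h⟩
  loopless := ⟨fun x h => by
    cases x
    · exact h
    · exact G.loopless.irrefl _ h⟩

/-- Quasi-threshold graphs: the smallest isomorphism-closed family of graphs that contains the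
one-vertex graph and is closed under adding a dominating vertex and under disjoint unions. -/
inductive IsQuasiThreshold : {V : Type} → SimpleGraph V → Prop
  | single : IsQuasiThreshold (⊥ : SimpleGraph Unit)
  | addDominating {V : Type} {G : SimpleGraph V} (hG : IsQuasiThreshold G) :
      IsQuasiThreshold G.addDominating
  | disjointUnion {V W : Type} {G : SimpleGraph V} {H : SimpleGraph W}
      (hG : IsQuasiThreshold G) (hH : IsQuasiThreshold H) : IsQuasiThreshold (G ⊕g H)
  | iso {V W : Type} {G : SimpleGraph V} {H : SimpleGraph W}
      (e : G ≃g H) (hG : IsQuasiThreshold G) : IsQuasiThreshold H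

/-- The number of labelled quasi-threshold graphs on `n` vertices with `ℓ` components. -/
noncomputable def qtcomp (n ℓ : ℕ) : ℕ :=
  Nat.card {G : SimpleGraph (Fin n) //
    G.IsQuasiThreshold ∧ Nat.card G.ConnectedComponent = ℓ}

/-- The number of connected labelled quasi-threshold graphs on `n` vertices. -/
noncomputable def qtconn (n : ℕ) : ℕ :=
  Nat.card {G : SimpleGraph (Fin n) // G.IsQuasiThreshold ∧ G.Connected}

end SimpleGraph

/-! Quasi-threshold graphs are the nonempty finite graphs with no induced path or cycle on four
vertices (`PathCycleFree`). The converse direction rests on `PathCycleFree.exists_isUniversal`: a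
connected such graph has a universal vertex.

Let `C` and `A` be the exponential generating functions of the connected graphs and of all graphs in
this class, the empty graph included in `A`. Decomposing into components gives `A = exp C`. Removing
the set of all universal vertices leaves a graph that is not connected, and this is reversible, so
`A = exp x * (A - C)`. Hence `C = z * exp C` with `z = 1 - exp (-x)`, that is, `C` is the tree
function evaluated at `z` (`pathCycleFreeEGF_one_eq`).

Lagrange inversion (`coeff_pow_of_eq_mul_exp_subst`) expands `C ^ ℓ / ℓ!` in the `z ^ k / k!` with
rooted forest numbers as coefficients, and the coefficients of `z ^ k / k!` are signed Stirling
numbers (`coeff_one_sub_exp_neg_pow`). -/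

namespace SimpleGraph

/-- A graph with no induced path and no induced cycle on four vertices. -/
def PathCycleFree {V : Type*} (G : SimpleGraph V) : Prop :=
  ∀ ⦃a b c d : V⦄, G.Adj a b → G.Adj b c → G.Adj c d → a ≠ c → b ≠ d → G.Adj a c ∨ G.Adj b d

/-! ### Forbidden-subgraph characterization -/

section Structure

variable {V W : Type*} {G : SimpleGraph V} {H : SimpleGraph W}

theorem PathCycleFree.of_embedding (hH : H.PathCycleFree) (f : G ↪g H) : G.PathCycleFree := by
  intro a b c d hab hbc hcd hac hbd
  simpa using hH (f.map_adj_iff.2 hab) (f.map_adj_iff.2 hbc) (f.map_adj_iff.2 hcd)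
    (f.injective.ne hac) (f.injective.ne hbd)

theorem Iso.pathCycleFree_iff (e : G ≃g H) : G.PathCycleFree ↔ H.PathCycleFree :=
  ⟨fun h => h.of_embedding e.symm.toEmbedding, fun h => h.of_embedding e.toEmbedding⟩

theorem pathCycleFree_sum_iff :
    (G ⊕g H).PathCycleFree ↔ G.PathCycleFree ∧ H.PathCycleFree := by
  refine ⟨fun h => ⟨h.of_embedding Embedding.sumInl, h.of_embedding Embedding.sumInr⟩, ?_⟩
  rintro ⟨hG, hH⟩ (a | a) (b | b) (c | c) (d | d) <;> simp
  · exact @hG a b c d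
  · exact @hH a b c d

theorem PathCycleFree.addDominating {V : Type} {G : SimpleGraph V} (hG : G.PathCycleFree) :
    G.addDominating.PathCycleFree := by
  rintro (_ | a) (_ | b) (_ | c) (_ | d) <;> simp [SimpleGraph.addDominating]
  exact @hG a b c d

theorem reachable_sum_iff {x y : V ⊕ W} :
    (G ⊕g H).Reachable x y ↔ Sum.LiftRel G.Reachable H.Reachable x y := by
  constructor
  · rw [reachable_iff_reflTransGen]
    intro h
    induction h with
    | refl => cases x <;> simp
    | @tail b c _ hbc ih =>
      rcases ih with @⟨a, b, hab⟩ | @⟨a, b, hab⟩ <;> rcases c with c | c <;> simp at hbc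
      · exact .inl (hab.trans hbc.reachable)
      · exact .inr (hab.trans hbc.reachable)
  · rintro (h | h)
    · exact h.map (Embedding.sumInl (G := G) (H := H)).toHom
    · exact h.map (Embedding.sumInr (G := G) (H := H)).toHom

theorem card_connectedComponent_sum [Finite V] [Finite W] :
    Nat.card (G ⊕g H).ConnectedComponent =
      Nat.card G.ConnectedComponent + Nat.card H.ConnectedComponent := by
  rw [← Nat.card_sum]
  refine (Nat.card_congr (Equiv.ofBijective (Sum.elim
    (ConnectedComponent.map (Embedding.sumInl (G := G) (H := H)).toHom)
    (ConnectedComponent.map (Embedding.sumInr (G := G) (H := H)).toHom)) ⟨?_, ?_⟩)).symm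
  · rintro (x | x) (y | y) <;> induction x using ConnectedComponent.ind <;>
      induction y using ConnectedComponent.ind <;> simp [reachable_sum_iff]
  · intro z
    induction z using ConnectedComponent.ind with
    | _ v =>
    rcases v with v | v
    · exact ⟨.inl (G.connectedComponentMk v), rfl⟩
    · exact ⟨.inr (H.connectedComponentMk v), rfl⟩

theorem card_connectedComponent_eq_one_iff :
    Nat.card G.ConnectedComponent = 1 ↔ G.Connected := by
  rw [Nat.card_eq_one_iff_unique]
  constructor
  · rintro ⟨hs, ⟨c⟩⟩
    have : Nonempty V := ⟨c.nonempty_supp.some⟩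
    exact ⟨fun u v => ConnectedComponent.exact (Subsingleton.elim _ _)⟩
  · intro h
    have := h.nonempty
    exact ⟨h.preconnected.subsingleton_connectedComponent, ⟨G.connectedComponentMk
      (Classical.arbitrary V)⟩⟩

/-- A vertex `v` of maximum degree works. Otherwise some path `v, u, w` has `w` not adjacent to `v`.
For any other neighbour `x` of `v`, the path `x, v, u, w` forces `x` adjacent to `u`, so `u` has
larger degree than `v`. -/
theorem PathCycleFree.exists_isUniversal [Finite V] (hG : G.PathCycleFree) (hc : G.Connected) :
    ∃ v, G.IsUniversal v := by
  classical
  have := Fintype.ofFinite V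
  have := hc.nonempty
  obtain ⟨v, hv⟩ := Finite.exists_max (fun v => G.degree v)
  refine ⟨v, ?_⟩
  by_contra hnot
  -- If no vertex were at distance two from `v`, induction along walks would make every other vertex
  -- adjacent to `v`.
  obtain ⟨u, w, hvu, huw, hne, hvw⟩ :
      ∃ u w, G.Adj v u ∧ G.Adj u w ∧ v ≠ w ∧ ¬ G.Adj v w := by
    by_contra! h
    refine hnot fun x hx => ?_
    have hr := hc.preconnected v x
    rw [reachable_iff_reflTransGen] at hr
    induction hr with
    | refl => exact absurd rfl hx
    | @tail b c _ hbc ih =>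
      by_cases hb : v = b
      · exact hb ▸ hbc
      · exact h b c (ih hb) hbc hx
  refine absurd (hv u) (not_le.2 ?_)
  have hsub : insert w (insert v ((G.neighborFinset v).erase u)) ⊆ G.neighborFinset u := by
    intro x hx
    simp only [Finset.mem_insert, Finset.mem_erase, mem_neighborFinset] at hx ⊢
    rcases hx with rfl | rfl | ⟨hxu, hvx⟩
    · exact huw
    · exact hvu.symm
    · exact ((hG hvx.symm hvu huw hxu hne).resolve_right hvw).symm
  have hcard := Finset.card_le_card hsub
  rw [Finset.card_insert_of_notMem, Finset.card_insert_of_notMem, Finset.card_erase_of_mem,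
    card_neighborFinset_eq_degree, card_neighborFinset_eq_degree] at hcard
  · have : 0 < G.degree v := (G.degree_pos_iff_exists_adj v).2 ⟨u, hvu⟩
    lia
  · simpa using hvu
  · simp
  · simp [hne.symm, hvw]

end Structure

theorem IsQuasiThreshold.pathCycleFree {V : Type} {G : SimpleGraph V} (hG : G.IsQuasiThreshold) :
    G.PathCycleFree := by
  induction hG with
  | single => intro a b c d h; exact absurd h (by simp)
  | addDominating _ ih => exact ih.addDominating
  | disjointUnion _ _ ih₁ ih₂ => exact pathCycleFree_sum_iff.2 ⟨ih₁, ih₂⟩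
  | iso e _ ih => exact e.pathCycleFree_iff.1 ih

/-- A graph with no edges between `p` and its complement is the disjoint sum of the two parts. -/
noncomputable def sumComapIso {V : Type*} (G : SimpleGraph V) (p : V → Prop)
    (h : ∀ a b, p a → ¬ p b → ¬ G.Adj a b) :
    (G.comap (Subtype.val : {x // p x} → V) ⊕g G.comap (Subtype.val : {x // ¬ p x} → V)) ≃g G where
  toEquiv := by classical exact Equiv.sumCompl p
  map_rel_iff' := by
    rintro (⟨a, ha⟩ | ⟨a, ha⟩) (⟨b, hb⟩ | ⟨b, hb⟩) <;> simp
    · exact h a b ha hb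
    · exact fun hab => h b a hb ha hab.symm

/-- A graph with a universal vertex is obtained by adding it to the rest. -/
noncomputable def IsUniversal.addDominatingIso {V : Type} {G : SimpleGraph V} {v : V}
    (h : G.IsUniversal v) :
    (G.comap (Subtype.val : {x // x ≠ v} → V)).addDominating ≃g G where
  toEquiv := by classical exact Equiv.optionSubtypeNe v
  map_rel_iff' := by
    rintro (_ | ⟨a, ha⟩) (_ | ⟨b, hb⟩) <;> simp [SimpleGraph.addDominating]
    · exact h hb.symm
    · exact (h ha.symm).symm

/-- Strong induction on the order: delete a universal vertex if the graph is connected, otherwise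
split off one component. -/
theorem PathCycleFree.isQuasiThreshold {V : Type} [Finite V] [Nonempty V] {G : SimpleGraph V}
    (hG : G.PathCycleFree) : G.IsQuasiThreshold := by
  induction hn : Nat.card V using Nat.strong_induction_on generalizing V with
  | _ n ih =>
  subst hn
  have key : ∀ (p : V → Prop), (∃ x, p x) → (∃ x, ¬ p x) →
      (G.comap (Subtype.val : {x // p x} → V)).IsQuasiThreshold := by
    rintro p ⟨x, hx⟩ ⟨y, hy⟩
    have : Nonempty {x // p x} := ⟨⟨x, hx⟩⟩
    exact ih _ (Finite.card_subtype_lt hy)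
      (hG.of_embedding (Embedding.comap (.subtype _) G)) rfl
  by_cases hc : G.Connected
  · obtain ⟨v, hv⟩ := hG.exists_isUniversal hc
    by_cases hne : ∃ w, w ≠ v
    · exact .iso hv.addDominatingIso (.addDominating (key _ hne ⟨v, by simp⟩))
    · push Not at hne
      refine .iso ⟨⟨fun _ => v, fun _ => (), fun _ => rfl, fun w => (hne w).symm⟩, ?_⟩ .single
      simp
  · obtain ⟨a, b, hab⟩ : ∃ a b, ¬ G.Reachable a b := by
      by_contra! h
      exact hc ⟨h⟩
    refine .iso (G.sumComapIso (G.Reachable a) fun x y hx hy hxy =>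
      hy (hx.trans hxy.reachable)) (.disjointUnion (key _ ⟨a, .refl a⟩ ⟨b, hab⟩) (key _ ⟨b, hab⟩ ?_))
    exact ⟨a, not_not.2 (.refl a)⟩

theorem isQuasiThreshold_iff_pathCycleFree {V : Type} [Finite V] [Nonempty V]
    {G : SimpleGraph V} : G.IsQuasiThreshold ↔ G.PathCycleFree :=
  ⟨fun h => h.pathCycleFree, fun h => h.isQuasiThreshold⟩

end SimpleGraph

/-! ### Decompositions by components and by universal vertices -/

namespace SimpleGraph

/-- The number of `P₄`- and `C₄`-free graphs on `V` with the number of components in `s`. -/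
noncomputable def pathCycleFreeCount (V : Type*) (s : Set ℕ) : ℕ :=
  Nat.card {G : SimpleGraph V // G.PathCycleFree ∧ Nat.card G.ConnectedComponent ∈ s}

section Counting

variable {V W : Type*}

theorem pathCycleFreeCount_congr (e : V ≃ W) (s : Set ℕ) :
    pathCycleFreeCount V s = pathCycleFreeCount W s := by
  refine Nat.card_congr (e.simpleGraph.subtypeEquiv fun G => ?_)
  have i : e.simpleGraph G ≃g G := Iso.comap e.symm G
  rw [i.pathCycleFree_iff, Nat.card_congr i.connectedComponentEquiv]

theorem pathCycleFreeCount_eq_fin [Finite V] (s : Set ℕ) :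
    pathCycleFreeCount V s = pathCycleFreeCount (Fin (Nat.card V)) s :=
  pathCycleFreeCount_congr (Finite.equivFin V) s

theorem sum_left_right_injective :
    Function.Injective (fun p : SimpleGraph V × SimpleGraph W => p.1 ⊕g p.2) := by
  rintro ⟨G, H⟩ ⟨G', H'⟩ h
  simp only at h
  refine Prod.ext ?_ ?_ <;> ext a b
  · simpa using iff_of_eq (congrArg (fun K => K.Adj (Sum.inl a) (Sum.inl b)) h)
  · simpa using iff_of_eq (congrArg (fun K => K.Adj (Sum.inr a) (Sum.inr b)) h)

theorem Iso.supp_map {G : SimpleGraph V} {H : SimpleGraph W} (e : G ≃g H)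
    (c : G.ConnectedComponent) : (e.connectedComponentEquiv c).supp = e '' c.supp := by
  ext w
  obtain ⟨v, rfl⟩ := e.surjective w
  induction c using ConnectedComponent.ind with
  | _ u =>
  simp [Iso.connectedComponentEquiv, Iso.reachable_iff]

theorem exists_supp_eq_range_inl_iff {G : SimpleGraph V} {H : SimpleGraph W} :
    (∃ c : (G ⊕g H).ConnectedComponent, c.supp = Set.range Sum.inl) ↔ G.Connected := by
  constructor
  · rintro ⟨c, hc⟩
    obtain ⟨x, hx⟩ := c.nonempty_supp
    obtain ⟨v, rfl⟩ : x ∈ Set.range Sum.inl := hc ▸ hx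
    have : Nonempty V := ⟨v⟩
    refine ⟨fun a b => ?_⟩
    have ha : Sum.inl a ∈ c.supp := hc ▸ Set.mem_range_self a
    have hb : Sum.inl b ∈ c.supp := hc ▸ Set.mem_range_self b
    have := ConnectedComponent.exact (ha.trans hb.symm)
    simpa [reachable_sum_iff] using this
  · intro h
    obtain ⟨v⟩ := h.nonempty
    refine ⟨(G ⊕g H).connectedComponentMk (.inl v), ?_⟩
    ext (x | x)
    · simp [reachable_sum_iff, h.preconnected x v]
    · simp [reachable_sum_iff]

open Classical in
/-- Graphs having `S` as a component are pairs of a connected graph on `S` and a graph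
on the complement. -/
theorem card_pathCycleFree_supp_eq [Finite V] (S : Finset V) (ℓ : ℕ) :
    Nat.card {G : SimpleGraph V // (G.PathCycleFree ∧ Nat.card G.ConnectedComponent = ℓ + 1) ∧
      ∃ c : G.ConnectedComponent, c.supp = S} =
    pathCycleFreeCount {x // x ∈ S} {1} * pathCycleFreeCount {x // x ∉ S} {ℓ} := by
  rw [pathCycleFreeCount, pathCycleFreeCount, ← Nat.card_prod]
  have hiso (G : SimpleGraph {x // x ∈ S}) (H : SimpleGraph {x // x ∉ S}) :
      ∃ e : (G ⊕g H) ≃g (Equiv.sumCompl (· ∈ S)).simpleGraph (G ⊕g H),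
        ∀ x, e x = Equiv.sumCompl (· ∈ S) x :=
    ⟨(Iso.comap (Equiv.sumCompl (· ∈ S)).symm (G ⊕g H)).symm, fun x => rfl⟩
  have hiff (G : SimpleGraph {x // x ∈ S}) (H : SimpleGraph {x // x ∉ S}) :
      ((((Equiv.sumCompl (· ∈ S)).simpleGraph (G ⊕g H)).PathCycleFree ∧
        Nat.card ((Equiv.sumCompl (· ∈ S)).simpleGraph (G ⊕g H)).ConnectedComponent = ℓ + 1) ∧
      ∃ c : ((Equiv.sumCompl (· ∈ S)).simpleGraph (G ⊕g H)).ConnectedComponent, c.supp = S) ↔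
      (G.PathCycleFree ∧ Nat.card G.ConnectedComponent = 1) ∧
        (H.PathCycleFree ∧ Nat.card H.ConnectedComponent = ℓ) := by
    obtain ⟨e, he⟩ := hiso G H
    have hsupp : (∃ c : ((Equiv.sumCompl (· ∈ S)).simpleGraph (G ⊕g H)).ConnectedComponent,
        c.supp = S) ↔ G.Connected := by
      have hS : (S : Set V) = e '' Set.range Sum.inl := by
        ext v
        simp only [← Set.range_comp, Set.mem_range, Function.comp_apply, he,
          Equiv.sumCompl_apply_inl]
        simp
      rw [← exists_supp_eq_range_inl_iff (H := H), e.connectedComponentEquiv.surjective.exists]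
      simp only [Iso.supp_map, hS, e.injective.image_injective.eq_iff]
    rw [hsupp, ← e.pathCycleFree_iff, ← Nat.card_congr e.connectedComponentEquiv,
      card_connectedComponent_sum, pathCycleFree_sum_iff, ← card_connectedComponent_eq_one_iff]
    constructor <;> rintro ⟨⟨h1, h2⟩, h3⟩
    · exact ⟨⟨h1.1, h3⟩, h1.2, by lia⟩
    · exact ⟨⟨⟨h1, h3.1⟩, by lia⟩, h2⟩
  refine (Nat.card_congr (Equiv.ofBijective (fun p =>
    ⟨(Equiv.sumCompl (· ∈ S)).simpleGraph (p.1.1 ⊕g p.2.1),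
      (hiff _ _).2 ⟨p.1.2, p.2.2⟩⟩) ⟨?_, ?_⟩)).symm
  · rintro ⟨⟨G, hG⟩, ⟨H, hH⟩⟩ ⟨⟨G', hG'⟩, ⟨H', hH'⟩⟩ h
    have h' := (Equiv.sumCompl (· ∈ S)).simpleGraph.injective (congrArg Subtype.val h)
    have := @sum_left_right_injective _ _ (G, H) (G', H') h'
    simpa using this
  · rintro ⟨G, hG, c, hc⟩
    have hcross : ∀ a b, a ∈ S → b ∉ S → ¬ G.Adj a b := by
      intro a b ha hb hab
      have ha' : a ∈ c.supp := hc ▸ ha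
      exact hb (Finset.mem_coe.1 (hc ▸ (c.mem_supp_congr_adj hab).1 ha'))
    have hG' : (Equiv.sumCompl (· ∈ S)).simpleGraph
        (G.comap (Subtype.val : {x // x ∈ S} → V) ⊕g G.comap (Subtype.val : {x // x ∉ S} → V)) =
        G := by
      rw [← Equiv.eq_symm_apply]
      ext (⟨a, ha⟩ | ⟨a, ha⟩) (⟨b, hb⟩ | ⟨b, hb⟩) <;> simp
      · exact hcross a b ha hb
      · exact fun hab => hcross b a hb ha hab.symm
    have := (hiff (G.comap Subtype.val) (G.comap Subtype.val)).1
      (by rw [hG']; exact ⟨hG, c, hc⟩)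
    exact ⟨⟨⟨_, this.1⟩, ⟨_, this.2⟩⟩, Subtype.ext hG'⟩

-- Double counting of pairs (graph, component): each graph has `ℓ + 1` components, and `S` is the
-- vertex set of the chosen one.
open Classical in
theorem succ_mul_pathCycleFreeCount [Fintype V] (ℓ : ℕ) :
    (ℓ + 1) * pathCycleFreeCount V {ℓ + 1} =
      ∑ S : Finset V,
        pathCycleFreeCount {x // x ∈ S} {1} * pathCycleFreeCount {x // x ∉ S} {ℓ} := by
  simp only [← card_pathCycleFree_supp_eq]
  have : Fintype {G : SimpleGraph V // G.PathCycleFree ∧ Nat.card G.ConnectedComponent = ℓ + 1} :=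
    Fintype.ofFinite _
  have h1 : Nat.card (Σ G : {G : SimpleGraph V //
      G.PathCycleFree ∧ Nat.card G.ConnectedComponent = ℓ + 1}, G.1.ConnectedComponent) =
      (ℓ + 1) * pathCycleFreeCount V {ℓ + 1} := by
    rw [Nat.card_sigma, Finset.sum_congr rfl fun G _ => G.2.2, Finset.sum_const, smul_eq_mul,
      mul_comm, Finset.card_univ, ← Nat.card_eq_fintype_card]
    rfl
  rw [← h1, ← Nat.card_sigma]
  refine Nat.card_congr (Equiv.ofBijective (fun p => ⟨p.2.supp.toFinset,
    ⟨p.1.1, p.1.2, p.2, by simp⟩⟩) ⟨?_, ?_⟩)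
  · rintro ⟨⟨G, hG⟩, c⟩ ⟨⟨G', hG'⟩, c'⟩ h
    have h1 := congrArg Sigma.fst h
    obtain rfl : G = G' := congrArg (fun q => q.2.1) h
    simp only [Set.toFinset_inj] at h1
    rw [ConnectedComponent.supp_injective h1]
  · rintro ⟨S, ⟨G, hG, c, hc⟩⟩
    obtain rfl : S = c.supp.toFinset := by ext; simp [hc]
    exact ⟨⟨⟨G, hG⟩, c⟩, rfl⟩

/-- The graph on `V` obtained from a graph on the complement of `S` by making the vertices of `S`
universal. -/
def joinUniversal (S : Finset V) (H : SimpleGraph {x // x ∉ S}) : SimpleGraph V where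
  Adj a b := a ≠ b ∧ ∀ (ha : a ∉ S) (hb : b ∉ S), H.Adj ⟨a, ha⟩ ⟨b, hb⟩
  symm := ⟨fun _ _ h => ⟨h.1.symm, fun ha hb => (h.2 hb ha).symm⟩⟩
  loopless := ⟨fun _ h => h.1 rfl⟩

theorem comap_joinUniversal (S : Finset V) (H : SimpleGraph {x // x ∉ S}) :
    (joinUniversal S H).comap Subtype.val = H := by
  ext ⟨a, ha⟩ ⟨b, hb⟩
  simp only [comap_adj, joinUniversal, ne_eq]
  exact ⟨fun h => h.2 ha hb, fun h => ⟨fun hab => h.ne (Subtype.ext hab), fun _ _ => h⟩⟩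

theorem isUniversal_joinUniversal_iff {S : Finset V} {H : SimpleGraph {x // x ∉ S}} {v : V} :
    (joinUniversal S H).IsUniversal v ↔ ∀ hv : v ∉ S, H.IsUniversal ⟨v, hv⟩ := by
  constructor
  · rintro h hv ⟨w, hw⟩ hne
    exact (h (fun hvw => hne (Subtype.ext hvw))).2 hv hw
  · intro h w hne
    exact ⟨hne, fun hv hw => h hv fun hvw => hne (Subtype.ext_iff.1 hvw)⟩

theorem pathCycleFree_joinUniversal_iff {S : Finset V} {H : SimpleGraph {x // x ∉ S}} :
    (joinUniversal S H).PathCycleFree ↔ H.PathCycleFree := by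
  constructor
  · intro h
    rw [← comap_joinUniversal S H]
    exact h.of_embedding (Embedding.comap (.subtype _) _)
  · intro h a b c d hab hbc hcd hac hbd
    by_contra! hcon
    have h1 : a ∉ S ∧ c ∉ S := by
      by_contra! h1
      exact hcon.1 ⟨hac, fun ha hc => absurd hc (not_not.2 (h1 ha))⟩
    have h2 : b ∉ S ∧ d ∉ S := by
      by_contra! h2
      exact hcon.2 ⟨hbd, fun ha hc => absurd hc (not_not.2 (h2 ha))⟩
    rcases h (hab.2 h1.1 h2.1) (hbc.2 h2.1 h1.2) (hcd.2 h1.2 h2.2)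
      (fun e => hac (Subtype.ext_iff.1 e)) (fun e => hbd (Subtype.ext_iff.1 e)) with h | h
    · exact hcon.1 ⟨hac, fun _ _ => h⟩
    · exact hcon.2 ⟨hbd, fun _ _ => h⟩

theorem joinUniversal_comap {G : SimpleGraph V} {S : Finset V} (h : ∀ v ∈ S, G.IsUniversal v) :
    joinUniversal S (G.comap Subtype.val) = G := by
  ext a b
  simp only [joinUniversal, comap_adj]
  refine ⟨fun hab => ?_, fun hab => ⟨hab.ne, fun _ _ => hab⟩⟩
  by_cases ha : a ∈ S
  · exact h a ha hab.1
  by_cases hb : b ∈ S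
  · exact (h b hb hab.1.symm).symm
  exact hab.2 ha hb

/-- Graphs whose set of universal vertices is `S ≠ ∅` are disconnected graphs on the complement. -/
theorem card_pathCycleFree_universal_eq [Finite V] {S : Finset V} (hS : S.Nonempty) :
    Nat.card {G : SimpleGraph V // (G.PathCycleFree ∧ Nat.card G.ConnectedComponent = 1) ∧
      ∀ v, v ∈ S ↔ G.IsUniversal v} = pathCycleFreeCount {x // x ∉ S} {1}ᶜ := by
  have hone (H : SimpleGraph {x // x ∉ S}) :
      Nat.card (joinUniversal S H).ConnectedComponent = 1 := by
    obtain ⟨v, hv⟩ := hS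
    exact card_connectedComponent_eq_one_iff.2 (Connected.of_isUniversal (v := v)
      (isUniversal_joinUniversal_iff.2 fun h => absurd hv h))
  have hmem (H : {G : SimpleGraph {x // x ∉ S} //
      G.PathCycleFree ∧ Nat.card G.ConnectedComponent ∈ ({1}ᶜ : Set ℕ)}) (v : V)
      (hv : (joinUniversal S H.1).IsUniversal v) : v ∈ S := by
    by_contra hvS
    exact H.2.2 (card_connectedComponent_eq_one_iff.2
      (Connected.of_isUniversal (isUniversal_joinUniversal_iff.1 hv hvS)))
  refine (Nat.card_congr (Equiv.ofBijective (fun H => ⟨joinUniversal S H.1,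
    ⟨pathCycleFree_joinUniversal_iff.2 H.2.1, hone H.1⟩, fun v => ⟨fun hv =>
      isUniversal_joinUniversal_iff.2 fun h => absurd hv h, hmem H v⟩⟩) ⟨?_, ?_⟩)).symm
  · intro H H' h
    refine Subtype.ext ?_
    have h' : joinUniversal S H.1 = joinUniversal S H'.1 := congrArg Subtype.val h
    rw [← comap_joinUniversal S H.1, ← comap_joinUniversal S H'.1, h']
  · rintro ⟨G, ⟨hG, hc⟩, hu⟩
    have hj := joinUniversal_comap fun v hv => (hu v).1 hv
    have hF : (G.comap (Subtype.val : {x // x ∉ S} → V)).PathCycleFree :=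
      hG.of_embedding (Embedding.comap (.subtype _) G)
    refine ⟨⟨G.comap Subtype.val, hF, fun h => ?_⟩, Subtype.ext hj⟩
    -- Were the rest connected, its universal vertex would be universal in `G` as well, hence
    -- already in `S`.
    obtain ⟨⟨v, hv⟩, hvu⟩ := hF.exists_isUniversal
      (card_connectedComponent_eq_one_iff.1 (Set.mem_singleton_iff.1 h))
    refine hv ((hu v).2 ?_)
    rw [← hj, isUniversal_joinUniversal_iff]
    exact fun _ => hvu

/-- Connected graphs are sorted by their nonempty set `S` of universal vertices. The complete graph
is the case `S = V`: the empty graph has zero components, so it is counted under `{1}ᶜ`. -/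
theorem pathCycleFreeCount_one [Fintype V] [DecidableEq V] :
    pathCycleFreeCount V {1} =
      ∑ S ∈ (Finset.univ : Finset (Finset V)).erase ∅, pathCycleFreeCount {x : V // x ∉ S} {1}ᶜ := by
  classical
  rw [Finset.sum_congr rfl fun S hS => (card_pathCycleFree_universal_eq
    (Finset.nonempty_iff_ne_empty.2 (Finset.ne_of_mem_erase hS))).symm]
  rw [← Finset.sum_coe_sort, ← Nat.card_sigma]
  refine Nat.card_congr (Equiv.ofBijective (fun G => ⟨⟨({v | G.1.IsUniversal v} : Finset V), ?_⟩,
    ⟨G.1, G.2, by simp⟩⟩) ⟨?_, ?_⟩)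
  · simp only [Finset.mem_erase, Finset.mem_univ, and_true, ← Finset.nonempty_iff_ne_empty]
    obtain ⟨v, hv⟩ := G.2.1.exists_isUniversal (card_connectedComponent_eq_one_iff.1 G.2.2)
    exact ⟨v, by simpa using hv⟩
  · rintro ⟨G, hG⟩ ⟨G', hG'⟩ h
    exact Subtype.ext (congrArg (fun q => q.2.1) h)
  · rintro ⟨⟨S, hS⟩, ⟨G, hG, hu⟩⟩
    obtain rfl : S = ({v | G.IsUniversal v} : Finset V) := by ext; simp [hu]
    exact ⟨⟨G, hG⟩, rfl⟩

theorem pathCycleFreeCount_add_compl [Finite V] (s : Set ℕ) :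
    pathCycleFreeCount V s + pathCycleFreeCount V sᶜ = pathCycleFreeCount V Set.univ := by
  classical
  have := Fintype.ofFinite V
  simp only [pathCycleFreeCount, Nat.card_eq_fintype_card, Fintype.card_subtype, Set.mem_univ,
    and_true, Set.mem_compl_iff]
  simp only [← Finset.filter_filter]
  exact Finset.card_filter_add_card_filter_not _

theorem pathCycleFreeCount_univ [Finite V] {N : ℕ} (h : Nat.card V < N) :
    pathCycleFreeCount V Set.univ = ∑ ℓ ∈ Finset.range N, pathCycleFreeCount V {ℓ} := by
  classical
  have := Fintype.ofFinite V
  simp only [pathCycleFreeCount, Nat.card_eq_fintype_card, Fintype.card_subtype, Set.mem_univ,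
    and_true, Set.mem_singleton_iff]
  simp only [← Finset.filter_filter]
  refine Finset.card_eq_sum_card_fiberwise fun G _ => ?_
  rw [Finset.coe_range, Set.mem_Iio, ← Nat.card_eq_fintype_card]
  exact (Nat.card_le_card_of_surjective G.connectedComponentMk Quot.mk_surjective).trans_lt h

theorem pathCycleFreeCount_zero [Nonempty V] [Finite V] : pathCycleFreeCount V {0} = 0 := by
  refine (Nat.card_eq_zero.2 (.inl ⟨fun G => ?_⟩))
  have : Nonempty G.1.ConnectedComponent := ⟨G.1.connectedComponentMk (Classical.arbitrary V)⟩
  exact Finite.card_pos.ne' (Set.mem_singleton_iff.1 G.2.2)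

theorem pathCycleFreeCount_zero_of_isEmpty [IsEmpty V] : pathCycleFreeCount V {0} = 1 := by
  refine Nat.card_eq_one_iff_unique.2 ⟨⟨fun G H => Subtype.ext (Subsingleton.elim _ _)⟩,
    ⟨⟨⊥, fun a => isEmptyElim a, ?_⟩⟩⟩
  have : IsEmpty (⊥ : SimpleGraph V).ConnectedComponent := ⟨fun c => isEmptyElim c.nonempty_supp.some⟩
  simp

theorem pathCycleFreeCount_one_of_isEmpty [IsEmpty V] : pathCycleFreeCount V {1} = 0 := by
  refine Nat.card_eq_zero.2 (.inl ⟨fun G => ?_⟩)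
  have := (card_connectedComponent_eq_one_iff.1 (Set.mem_singleton_iff.1 G.2.2)).nonempty
  exact isEmptyElim this.some

end Counting

theorem succ_mul_pathCycleFreeCount_fin (n ℓ : ℕ) :
    (ℓ + 1) * pathCycleFreeCount (Fin n) {ℓ + 1} =
      ∑ i ∈ Finset.range (n + 1), n.choose i *
        (pathCycleFreeCount (Fin i) {1} * pathCycleFreeCount (Fin (n - i)) {ℓ}) := by
  have h := Finset.sum_powerset_apply_card (fun i => pathCycleFreeCount (Fin i) {1} *
    pathCycleFreeCount (Fin (n - i)) {ℓ}) (x := (Finset.univ : Finset (Fin n)))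
  simp only [Finset.card_univ, Fintype.card_fin, smul_eq_mul, Finset.powerset_univ] at h
  rw [← h, succ_mul_pathCycleFreeCount]
  refine Finset.sum_congr rfl fun S _ => ?_
  rw [pathCycleFreeCount_eq_fin, pathCycleFreeCount_eq_fin (V := {x // x ∉ S})]
  simp [Fintype.card_subtype_compl]

/-- The term `S = ∅`, absent for connected graphs, supplies exactly the graphs that are not
connected. The factor `1` is kept to match the product formula `egf_mul`. -/
theorem pathCycleFreeCount_univ_fin (n : ℕ) :
    pathCycleFreeCount (Fin n) Set.univ =
      ∑ i ∈ Finset.range (n + 1), n.choose i * (1 * pathCycleFreeCount (Fin (n - i)) {1}ᶜ) := by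
  have h := Finset.sum_powerset_apply_card (fun i => 1 * pathCycleFreeCount (Fin (n - i)) {1}ᶜ)
    (x := (Finset.univ : Finset (Fin n)))
  simp only [Finset.card_univ, Fintype.card_fin, smul_eq_mul, Finset.powerset_univ] at h
  rw [← h, ← pathCycleFreeCount_add_compl {1}, pathCycleFreeCount_one,
    ← Finset.sum_erase_add _ _ (Finset.mem_univ ∅)]
  congr 1
  · refine Finset.sum_congr rfl fun S _ => ?_
    rw [pathCycleFreeCount_eq_fin (V := {x // x ∉ S})]
    simp [Fintype.card_subtype_compl]
  · simp

end SimpleGraph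

/-! ### Stirling numbers as coefficients of powers of `1 - exp (-x)` -/

namespace PowerSeries

theorem constantCoeff_one_sub_exp_neg : constantCoeff (1 - evalNegHom (exp ℚ)) = 0 := by
  rw [← coeff_zero_eq_constantCoeff_apply, map_sub, evalNegHom, coeff_rescale]
  simp

/-- With `z = 1 - exp (-x)`, `z' = 1 - z`, so the derivative of `z ^ (k + 1)` is `(k + 1) * (z ^ k -
z ^ (k + 1))`. On coefficients this is the signed Stirling recurrence. -/
theorem coeff_one_sub_exp_neg_pow (n k : ℕ) :
    (n.factorial : ℚ) * coeff n ((1 - evalNegHom (exp ℚ)) ^ k) =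
      k.factorial * ((-1) ^ (n + k) * (Nat.stirlingSecond n k : ℚ)) := by
  have hd : d⁄dX ℚ (1 - evalNegHom (exp ℚ)) = evalNegHom (exp ℚ) := by
    ext n
    simp [coeff_derivative, evalNegHom, coeff_rescale, coeff_exp, Nat.factorial_succ]
    field_simp
    ring
  induction n generalizing k with
  | zero =>
    rcases k with _ | k
    · simp
    · simp [Nat.stirlingSecond, constantCoeff_one_sub_exp_neg]
  | succ n ih =>
    rcases k with _ | k
    · simp [Nat.stirlingSecond, coeff_one]
    · have h : d⁄dX ℚ ((1 - evalNegHom (exp ℚ)) ^ (k + 1)) =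
          (k + 1 : ℚ) • ((1 - evalNegHom (exp ℚ)) ^ k - (1 - evalNegHom (exp ℚ)) ^ (k + 1)) := by
        rw [Derivation.leibniz_pow, hd]
        rw [Nat.add_sub_cancel, smul_eq_mul, nsmul_eq_mul, smul_eq_C_mul]
        have : C (k + 1 : ℚ) = ((k + 1 : ℕ) : ℚ⟦X⟧) := by simp
        rw [this]
        ring
      have h2 := congrArg (coeff n) h
      rw [coeff_derivative, coeff_smul, map_sub, smul_eq_mul] at h2
      rw [Nat.factorial_succ, Nat.cast_mul, mul_assoc, mul_left_comm]
      push_cast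
      rw [mul_comm ((n : ℚ) + 1), h2, mul_left_comm, mul_sub, ih, ih, Nat.stirlingSecond_succ_succ,
        Nat.factorial_succ]
      push_cast
      ring

end PowerSeries

/-! ### Rooted forest numbers -/

/-- The number of rooted forests on `k` labelled vertices with `ℓ` trees. -/
def rootedForestCount : ℕ → ℕ → ℕ
  | 0, 0 => 1
  | 0, _ + 1 => 0
  | _ + 1, 0 => 0
  -- The truncated subtraction is harmless: the binomial vanishes when `k < ℓ`.
  | k + 1, ℓ + 1 => k.choose ℓ * (k + 1) ^ (k - ℓ)

theorem rootedForestCount_eq_zero_of_lt {k ℓ : ℕ} (h : k < ℓ) : rootedForestCount k ℓ = 0 := by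
  rcases k with _ | k <;> rcases ℓ with _ | ℓ <;> simp [rootedForestCount] at h ⊢
  exact Nat.choose_eq_zero_of_lt h

theorem cast_rootedForestCount {k ℓ : ℕ} (hk : k ≠ 0) (hℓ : ℓ ≠ 0) :
    (rootedForestCount k ℓ : ℚ) = ℓ * (k.choose ℓ : ℚ) * (k : ℚ) ^ ((k : ℤ) - ℓ - 1) := by
  obtain ⟨k, rfl⟩ := Nat.exists_eq_succ_of_ne_zero hk
  obtain ⟨ℓ, rfl⟩ := Nat.exists_eq_succ_of_ne_zero hℓ
  rcases lt_or_ge k ℓ with h | h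
  · rw [rootedForestCount_eq_zero_of_lt (by lia), Nat.choose_eq_zero_of_lt (by lia)]
    simp
  · obtain ⟨d, rfl⟩ := Nat.exists_eq_add_of_le h
    have hz : (((ℓ + d).succ : ℕ) : ℤ) - ((ℓ.succ : ℕ) : ℤ) - 1 = (d : ℤ) - 1 := by push_cast; ring
    have hq : (((ℓ + d).succ : ℕ) : ℚ) ≠ 0 := by positivity
    have hch : (((ℓ + d).succ : ℕ) : ℚ) * ((ℓ + d).choose ℓ : ℚ) =
        ((ℓ + d).succ.choose ℓ.succ : ℚ) * (ℓ.succ : ℕ) := by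
      exact_mod_cast Nat.add_one_mul_choose_eq (ℓ + d) ℓ
    rw [hz, zpow_sub_one₀ hq, zpow_natCast, mul_comm (ℓ.succ : ℚ), ← hch]
    simp only [rootedForestCount, Nat.add_sub_cancel_left]
    push_cast at hq ⊢
    field_simp

/-- The binomial theorem for `(y + (k + 1)) ^ k`, after the factor `y` is taken out. -/
theorem sum_rootedForestCount_succ_mul_pow (k y : ℕ) {N : ℕ} (hN : k + 1 < N) :
    ∑ m ∈ Finset.range N, rootedForestCount (k + 1) m * y ^ m = y * (y + (k + 1)) ^ k := by
  have h : ∑ m ∈ Finset.range N, rootedForestCount (k + 1) m * y ^ m =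
      ∑ m ∈ Finset.range (k + 2), rootedForestCount (k + 1) m * y ^ m := by
    refine (Finset.sum_subset (Finset.range_mono hN) fun m _ hm => ?_).symm
    rw [rootedForestCount_eq_zero_of_lt (by simp at hm; lia), zero_mul]
  rw [h, Finset.sum_range_succ', add_pow, Finset.mul_sum]
  simp only [rootedForestCount, zero_mul, add_zero]
  refine Finset.sum_congr rfl fun m _ => ?_
  simp only [Nat.cast_id]
  ring

/-- Removing the roots of a rooted forest. -/
theorem rootedForestCount_add (k ℓ : ℕ) (hℓ : ℓ ≠ 0) {N : ℕ} (hN : k < N) :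
    rootedForestCount (ℓ + k) ℓ =
      (ℓ + k).choose ℓ * ∑ m ∈ Finset.range N, rootedForestCount k m * ℓ ^ m := by
  obtain ⟨ℓ, rfl⟩ := Nat.exists_eq_succ_of_ne_zero hℓ
  rcases k with _ | k
  · rw [Finset.sum_eq_single_of_mem 0 (by simpa using hN)]
    · simp [rootedForestCount]
    · intro m _ hm
      rw [rootedForestCount_eq_zero_of_lt (Nat.pos_of_ne_zero hm), zero_mul]
  · rw [sum_rootedForestCount_succ_mul_pow k _ hN]
    have h1 : ℓ.succ + (k + 1) = (ℓ + k + 1) + 1 := by lia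
    have h2 : ℓ + k + 1 - ℓ = k + 1 := by lia
    rw [h1]
    simp only [rootedForestCount, h2]
    rw [← mul_assoc, Nat.succ_eq_add_one, ← Nat.add_one_mul_choose_eq]
    ring

/-! ### Lagrange inversion for the tree function -/

namespace PowerSeries

theorem coeff_pow_eq_zero_of_constantCoeff {f : ℚ⟦X⟧} (hf : constantCoeff f = 0) {n m : ℕ}
    (h : n < m) : coeff n (f ^ m) = 0 :=
  X_pow_dvd_iff.1 (pow_dvd_pow_of_dvd (X_dvd_iff.2 hf) m) n h

theorem coeff_exp_subst_pow {f : ℚ⟦X⟧} (hf : constantCoeff f = 0) (ℓ : ℕ) {n N : ℕ} (h : n < N) :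
    coeff n (((exp ℚ).subst f) ^ ℓ) =
      ∑ m ∈ Finset.range N, (ℓ : ℚ) ^ m * (coeff n (f ^ m) / m.factorial) := by
  have hs : HasSubst f := HasSubst.of_constantCoeff_zero' hf
  rw [← subst_pow hs, exp_pow_eq_rescale_exp, coeff_subst' hs,
    finsum_eq_sum_of_support_subset (s := Finset.range N)]
  · refine Finset.sum_congr rfl fun m _ => ?_
    simp [coeff_rescale, coeff_exp]
    ring
  · intro m hm
    by_contra hmN
    refine hm ?_
    simp only [Finset.coe_range, Set.mem_Iio, not_lt] at hmN
    simp [coeff_pow_eq_zero_of_constantCoeff hf (h.trans_le hmN)]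

/-- Lagrange inversion for the tree function: the powers of the solution of `f = z * exp f`. -/
theorem coeff_pow_of_eq_mul_exp_subst {f z : ℚ⟦X⟧} (hf : constantCoeff f = 0)
    (hz : constantCoeff z = 0) (h : f = z * (exp ℚ).subst f) {n N : ℕ} (hn : n < N) (ℓ : ℕ) :
    coeff n (f ^ ℓ) / ℓ.factorial =
      ∑ k ∈ Finset.range N, (rootedForestCount k ℓ : ℚ) * (coeff n (z ^ k) / k.factorial) := by
  induction n using Nat.strong_induction_on generalizing ℓ with
  | _ n ih =>
  rcases Nat.eq_zero_or_pos ℓ with rfl | hℓ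
  · rw [Finset.sum_eq_single_of_mem 0 (by simpa using by lia)]
    · simp [rootedForestCount]
    · intro k _ hk
      obtain ⟨k, rfl⟩ := Nat.exists_eq_succ_of_ne_zero hk
      simp [rootedForestCount]
  -- Expand `f ^ ℓ = z ^ ℓ * exp (ℓ * f)`. As `z ^ ℓ` has no constant term, only coefficients of
  -- powers of `f` below degree `n` enter, and induction applies to them.
  have hstep : coeff n (f ^ ℓ) = ∑ K ∈ Finset.range N,
      ((∑ m ∈ Finset.range N, rootedForestCount K m * ℓ ^ m : ℕ) : ℚ) *
        (coeff n (z ^ (ℓ + K)) / K.factorial) := by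
    have hpow : f ^ ℓ = z ^ ℓ * ((exp ℚ).subst f) ^ ℓ := by rw [← mul_pow, ← h]
    rw [hpow, coeff_mul]
    simp only [pow_add, coeff_mul, Finset.sum_div, Finset.mul_sum]
    rw [Finset.sum_comm]
    refine Finset.sum_congr rfl fun ij hij => ?_
    rw [Finset.HasAntidiagonal.mem_antidiagonal] at hij
    rcases Nat.eq_zero_or_pos ij.1 with h0 | h0
    · have : coeff ij.1 (z ^ ℓ) = 0 :=
        coeff_pow_eq_zero_of_constantCoeff hz (h0 ▸ hℓ)
      simp [this]
    · rw [coeff_exp_subst_pow hf ℓ (show ij.2 < N by lia), Finset.mul_sum]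
      simp only [ih ij.2 (by lia) (by lia), Finset.mul_sum]
      rw [Finset.sum_comm]
      refine Finset.sum_congr rfl fun K _ => ?_
      push_cast
      rw [Finset.sum_mul]
      refine Finset.sum_congr rfl fun m _ => ?_
      ring
  have hshift : ∑ k ∈ Finset.range N, (rootedForestCount k ℓ : ℚ) *
      (coeff n (z ^ k) / k.factorial) = ∑ K ∈ Finset.range N,
        (rootedForestCount (ℓ + K) ℓ : ℚ) * (coeff n (z ^ (ℓ + K)) / (ℓ + K).factorial) := by
    -- Both sums equal the one over `k < ℓ + N`: terms with `k < ℓ` vanish through the forest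
    -- number, those with `k ≥ N > n` through `z ^ k`.
    have h1 := Finset.sum_range_add (fun k => (rootedForestCount k ℓ : ℚ) *
      (coeff n (z ^ k) / k.factorial)) ℓ N
    have h2 := Finset.sum_range_add (fun k => (rootedForestCount k ℓ : ℚ) *
      (coeff n (z ^ k) / k.factorial)) N ℓ
    rw [Finset.sum_eq_zero (s := Finset.range ℓ), zero_add] at h1
    · rw [Finset.sum_eq_zero (s := Finset.range ℓ), add_zero] at h2
      · rw [← h1, ← h2, add_comm]
      · intro k _
        rw [coeff_pow_eq_zero_of_constantCoeff hz (by lia)]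
        simp
    · intro k hk
      rw [rootedForestCount_eq_zero_of_lt (by simpa using hk)]
      simp
  rw [hstep, hshift, Finset.sum_div]
  refine Finset.sum_congr rfl fun K hK => ?_
  rw [rootedForestCount_add K ℓ hℓ.ne' (by simpa using hK), Nat.cast_mul, Nat.cast_add_choose]
  have : ((ℓ + K).factorial : ℚ) ≠ 0 := by positivity
  field_simp

end PowerSeries

/-! ### Generating functions and the functional equation -/

namespace SimpleGraph

open PowerSeries

/-- The exponential generating function of a sequence of natural numbers. -/
noncomputable def egf (u : ℕ → ℕ) : ℚ⟦X⟧ := PowerSeries.mk fun n => (u n : ℚ) / n.factorial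

theorem egf_mul (u v : ℕ → ℕ) :
    egf u * egf v = egf fun n => ∑ i ∈ Finset.range (n + 1), n.choose i * (u i * v (n - i)) := by
  ext n
  rw [coeff_mul, egf, egf, egf, coeff_mk, Finset.Nat.sum_antidiagonal_eq_sum_range_succ_mk]
  push_cast
  rw [Finset.sum_div]
  refine Finset.sum_congr rfl fun i hi => ?_
  rw [coeff_mk, coeff_mk, Nat.cast_choose ℚ (Finset.mem_range_succ_iff.1 hi)]
  have : (n.factorial : ℚ) ≠ 0 := by positivity
  field_simp

/-- The exponential generating function of labelled `P₄`- and `C₄`-free graphs with the number of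
components in `s`. -/
noncomputable def pathCycleFreeEGF (s : Set ℕ) : ℚ⟦X⟧ := egf fun n => pathCycleFreeCount (Fin n) s

theorem constantCoeff_pathCycleFreeEGF_one : constantCoeff (pathCycleFreeEGF {1}) = 0 := by
  rw [← coeff_zero_eq_constantCoeff_apply, pathCycleFreeEGF, egf, coeff_mk,
    pathCycleFreeCount_one_of_isEmpty]
  simp

theorem pathCycleFreeEGF_zero : pathCycleFreeEGF {0} = 1 := by
  ext n
  rw [pathCycleFreeEGF, egf, coeff_mk, coeff_one]
  rcases n with _ | n
  · simp [pathCycleFreeCount_zero_of_isEmpty]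
  · simp [pathCycleFreeCount_zero]

theorem pathCycleFreeEGF_succ (ℓ : ℕ) :
    (ℓ + 1 : ℚ) • pathCycleFreeEGF {ℓ + 1} = pathCycleFreeEGF {1} * pathCycleFreeEGF {ℓ} := by
  rw [pathCycleFreeEGF, pathCycleFreeEGF, pathCycleFreeEGF, egf_mul]
  ext n
  rw [coeff_smul, egf, egf, coeff_mk, coeff_mk, ← succ_mul_pathCycleFreeCount_fin]
  push_cast
  rw [smul_eq_mul, mul_div_assoc]

theorem pathCycleFreeEGF_singleton (ℓ : ℕ) :
    (ℓ.factorial : ℚ) • pathCycleFreeEGF {ℓ} = pathCycleFreeEGF {1} ^ ℓ := by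
  induction ℓ with
  | zero => simp [pathCycleFreeEGF_zero]
  | succ ℓ ih =>
    rw [pow_succ', ← ih, mul_smul_comm, ← pathCycleFreeEGF_succ, smul_smul, Nat.factorial_succ]
    push_cast
    rw [mul_comm]

theorem coeff_pathCycleFreeEGF_one_pow (n ℓ : ℕ) :
    coeff n (pathCycleFreeEGF {1} ^ ℓ) / ℓ.factorial =
      (pathCycleFreeCount (Fin n) {ℓ} : ℚ) / n.factorial := by
  rw [← pathCycleFreeEGF_singleton, coeff_smul, smul_eq_mul,
    mul_div_cancel_left₀ _ (by positivity), pathCycleFreeEGF, egf, coeff_mk]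

/-- The exponential formula: the summand `C ^ m / m!` of `exp C` counts the graphs with `m`
components. -/
theorem exp_subst_pathCycleFreeEGF_one :
    (exp ℚ).subst (pathCycleFreeEGF {1}) = pathCycleFreeEGF Set.univ := by
  ext n
  have h := coeff_exp_subst_pow constantCoeff_pathCycleFreeEGF_one 1 n.lt_succ_self
  rw [pow_one] at h
  simp only [coeff_pathCycleFreeEGF_one_pow, Nat.cast_one, one_pow, one_mul] at h
  rw [h, pathCycleFreeEGF, egf, coeff_mk, pathCycleFreeCount_univ (N := n + 1) (by simp),
    Nat.cast_sum, Finset.sum_div]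

theorem pathCycleFreeEGF_univ :
    pathCycleFreeEGF Set.univ = exp ℚ * pathCycleFreeEGF {1}ᶜ := by
  have h : exp ℚ = egf fun _ => 1 := by
    ext n
    simp [egf, coeff_exp]
  rw [h, pathCycleFreeEGF, pathCycleFreeEGF, egf_mul]
  simp only [pathCycleFreeCount_univ_fin]

theorem pathCycleFreeEGF_one_eq :
    pathCycleFreeEGF {1} =
      (1 - evalNegHom (exp ℚ)) * (exp ℚ).subst (pathCycleFreeEGF {1}) := by
  have h : pathCycleFreeEGF {1} + pathCycleFreeEGF {1}ᶜ = pathCycleFreeEGF Set.univ := by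
    ext n
    simp only [pathCycleFreeEGF, egf, map_add, coeff_mk, ← pathCycleFreeCount_add_compl {1}]
    push_cast
    ring
  rw [exp_subst_pathCycleFreeEGF_one, sub_mul, one_mul]
  nth_rw 2 [pathCycleFreeEGF_univ]
  rw [← mul_assoc, mul_comm (evalNegHom _), exp_mul_exp_neg_eq_one, ← h]
  ring

theorem pathCycleFreeCount_singleton {n : ℕ} (hn : n ≠ 0) (ℓ : ℕ) :
    (pathCycleFreeCount (Fin n) {ℓ} : ℤ) = ∑ k ∈ Finset.Icc 1 n,
      (-1) ^ (n + k) * (Nat.stirlingSecond n k : ℤ) * rootedForestCount k ℓ := by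
  have hz : constantCoeff (1 - evalNegHom (exp ℚ)) = 0 := constantCoeff_one_sub_exp_neg
  have h := coeff_pow_of_eq_mul_exp_subst constantCoeff_pathCycleFreeEGF_one hz
    pathCycleFreeEGF_one_eq n.lt_succ_self ℓ
  rw [coeff_pathCycleFreeEGF_one_pow, div_eq_iff (by positivity)] at h
  suffices hq : (pathCycleFreeCount (Fin n) {ℓ} : ℚ) = ∑ k ∈ Finset.Icc 1 n,
      (-1) ^ (n + k) * (Nat.stirlingSecond n k : ℚ) * rootedForestCount k ℓ by
    exact_mod_cast hq
  have hk (k : ℕ) : (rootedForestCount k ℓ : ℚ) *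
      (coeff n ((1 - evalNegHom (exp ℚ)) ^ k) / k.factorial) * n.factorial =
      (-1) ^ (n + k) * (Nat.stirlingSecond n k : ℚ) * rootedForestCount k ℓ := by
    have h1 := coeff_one_sub_exp_neg_pow n k
    have : (k.factorial : ℚ) ≠ 0 := by positivity
    field_simp
    linear_combination (rootedForestCount k ℓ : ℚ) * h1
  rw [h, Finset.sum_mul]
  simp only [hk]
  -- The term `k = 0` drops out because `S(n, 0) = 0` for `n ≥ 1`.
  rw [Nat.succ_eq_add_one, Finset.sum_range_eq_add_Ico _ n.succ_pos]
  obtain ⟨n, rfl⟩ := Nat.exists_eq_succ_of_ne_zero hn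
  simp only [Nat.succ_eq_add_one, Nat.stirlingSecond_succ_zero, Nat.cast_zero, mul_zero, zero_mul,
    zero_add]
  rfl

theorem qtcomp_eq_pathCycleFreeCount {n : ℕ} (hn : n ≠ 0) (ℓ : ℕ) :
    qtcomp n ℓ = pathCycleFreeCount (Fin n) {ℓ} := by
  have : Nonempty (Fin n) := Fin.pos_iff_nonempty.1 (Nat.pos_of_ne_zero hn)
  simp only [qtcomp, isQuasiThreshold_iff_pathCycleFree, pathCycleFreeCount,
    Set.mem_singleton_iff]

theorem qtconn_eq_qtcomp_one (n : ℕ) : qtconn n = qtcomp n 1 := by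
  simp only [qtconn, qtcomp, card_connectedComponent_eq_one_iff]

end SimpleGraph

/-- The exponent `k - ℓ - 1` is taken in `ℤ` (it is `-1` for `k = ℓ`), with values in `ℚ`. -/
theorem mainTheorem3 (n : ℕ) (hn : 1 ≤ n) :
    (∀ ℓ : ℕ, 1 ≤ ℓ →
      (SimpleGraph.qtcomp n ℓ : ℚ) =
        ∑ k ∈ Finset.Icc 1 n, (-1 : ℚ) ^ (n - k) * (Nat.stirlingSecond n k : ℚ) *
          ((ℓ : ℚ) * (Nat.choose k ℓ : ℚ) * (k : ℚ) ^ ((k : ℤ) - (ℓ : ℤ) - 1))) ∧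
    (SimpleGraph.qtconn n : ℤ) =
      ∑ k ∈ Finset.Icc 1 n, (-1 : ℤ) ^ (n + k) * (Nat.stirlingSecond n k : ℤ) *
        (k : ℤ) ^ (k - 1) := by
  have hn0 : n ≠ 0 := Nat.one_le_iff_ne_zero.1 hn
  refine ⟨fun ℓ hℓ => ?_, ?_⟩
  · have h := congrArg (Int.cast : ℤ → ℚ) (SimpleGraph.pathCycleFreeCount_singleton hn0 ℓ)
    rw [SimpleGraph.qtcomp_eq_pathCycleFreeCount hn0]
    push_cast at h
    rw [h]
    refine Finset.sum_congr rfl fun k hk => ?_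
    obtain ⟨hk1, hkn⟩ := Finset.mem_Icc.1 hk
    rw [cast_rootedForestCount (by lia) (by lia)]
    -- The signs agree: `n + k` and `n - k` differ by `2 * k`.
    obtain ⟨d, rfl⟩ := Nat.exists_eq_add_of_le hkn
    rw [Nat.add_sub_cancel_left, show k + d + k = 2 * k + d by ring, pow_add, pow_mul]
    simp
  · rw [SimpleGraph.qtconn_eq_qtcomp_one, SimpleGraph.qtcomp_eq_pathCycleFreeCount hn0,
      SimpleGraph.pathCycleFreeCount_singleton hn0]
    refine Finset.sum_congr rfl fun k hk => ?_
    obtain ⟨k, rfl⟩ := Nat.exists_eq_succ_of_ne_zero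
      (Nat.one_le_iff_ne_zero.1 (Finset.mem_Icc.1 hk).1)
    simp [rootedForestCount]
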